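/- A zero-error channel $\mathcal W$ from a finite non-empty set $\mathcal X$ to a set $\mathcal Y$ is a relation $\mathcal W\subseteq\mathcal X\times\mathcal Y$ such that every $x\in\mathcal X$ has at least one possible output $y$, i.e. $(x,y)\in\mathcal W$. We write $\mathcal W\to\mathcal V$ if, for some number $m$ of uses, there are an encoder from inputs of $\mathcal V$ to $\mathcal X^m$ and a decoder from $\mathcal Y^m$ to outputs of $\mathcal V$ such that, for every input of $\mathcal V$ and all possible outputs of the $m$ uses of $\mathcal W$, the decoded value is a valid output of $\mathcal V$ for that input. For an integer $a\ge 1$, $\mathrm{List}_a$ is the channel with inputs $\{1,\dots,a+1\}$ whose possible outputs on $x$ are the $a$-element subsets of $\{1,\dots,a+1\}$ containing $x$; $\mathrm{List}_\infty$ is the trivial channel with one input and one output. The ambiguity $A(\mathcal W)$ is the unique $a\in\{1,2,\dots\}\cup\{\infty\}$ with $\mathcal W\to\mathrm{List}_a$ and $\mathrm{List}_a\to\mathcal W$. Let $\mathcal W_1,\dots,\mathcal W_n$ be zero-error channels, $\mathcal W_j$ from $\mathcal X_j$ to $\mathcal Y_j$, and let $\mathcal H=\{h_1,\dots,h_k\}$,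 $k\ge 1$, $h_i\subseteq\{1,\dots,n\}$, be an honest-set structure. Their parallel concatenation $\mathcal W_p$ takes in each use one input symbol for every channel and delivers one output symbol from every channel; a sequence of outputs of $m$ uses is possible if there is one honest set $h_i$, the same in all $m$ uses, such that for every $j\in h_i$ all outputs of channel $j$ are possible outputs of $\mathcal W_j$ for the corresponding inputs (the channels outside $h_i$ are malicious and output arbitrary symbols). As above, $\mathcal W_p\to\mathcal V$ means that some number of uses of $\mathcal W_p$ suffices to realize $\mathcal V$ without error, $\mathcal V\to\mathcal W_p$ means that for every $m$ the $m$-fold use of $\mathcal W_p$ can be realized by using $\mathcal V$, and $A(\mathcal W_p)$ is the $a$ with $\mathcal W_p\to\mathrm{List}_a$ and $\mathrm{List}_a\to\mathcal W_p$. Theorem. The ambiguities $A(\mathcal W_1),\dots,A(\mathcal W_n)$ and $A(\mathcal W_p)$ exist and are unique, and $$A(\mathcal W_p)=\max_{a_1,\dots,a_k}\sum_{i=1}^k a_i,$$ where the maximum is over all nonnegative integers $a_1,\dots,a_k$ such that $\sum_{i:\,j\in h_i}a_i\le A(\mathcal W_j)$ for all $j\in\{1,\dots,n\}$. (If these sums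 are unbounded, the maximum is read as the supremum $\infty$; otherwise it is attained.) -/

import Mathlib

/-- A zero-error channel with input domain `X` and output range `Y`: a relation giving the possible
input/output pairs, such that every input has at least one possible output. -/
structure ZeroErrorChannel (X Y : Type*) where
  rel : X → Y → Prop
  total : ∀ x, ∃ y, rel x y

namespace ZeroErrorChannel

/-- The channel of `m` independent invocations of `W`. -/
def uses {X Y : Type*} (W : ZeroErrorChannel X Y) (m : ℕ) :
    ZeroErrorChannel (Fin m → X) (Fin m → Y) where
  rel x y := ∀ t, W.rel (x t) (y t)
  total x := Classical.skolem.1 fun t => W.total (x t)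

/-- One invocation of `W` suffices to get `V`: for every input and every possible output of the
invocation, the output of the decoder is valid for `V`. -/
def Simulates {X₀ Y₀ X₁ Y₁ : Type*} (W : ZeroErrorChannel X₀ Y₀) (V : ZeroErrorChannel X₁ Y₁) :
    Prop :=
  ∃ (enc : X₁ → X₀) (dec : Y₀ → Y₁), ∀ x y, W.rel (enc x) y → V.rel x (dec y)

/-- `W → V`: there is a protocol (without feedback), using `W` some finite number of times, that
realizes `V` without error. -/
def Achieves {X₀ Y₀ X₁ Y₁ : Type*} (W : ZeroErrorChannel X₀ Y₀) (V : ZeroErrorChannel X₁ Y₁) :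
    Prop :=
  ∃ m : ℕ, (W.uses m).Simulates V

/-- The `List_{a,d}`-channel, `1 ≤ a < d`: the input is one of `d` values and the output is
a set of exactly `a` values that contains the input. -/
def list (a d : ℕ) (ha : 0 < a) (had : a < d) :
    ZeroErrorChannel (Fin d) {y : Finset (Fin d) // y.card = a} where
  rel x y := x ∈ y.1
  total x := by
    obtain ⟨y, hxy, -, hy⟩ := Finset.exists_subsuperset_card_eq
      (Finset.subset_univ {x}) (n := a) (by simpa using Nat.succ_le_of_lt ha) (by simpa using had.le)
    exact ⟨⟨y, hy⟩, by simpa using hxy⟩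

/-- The channel `List_∞`, over which no communication is possible. -/
def trivial : ZeroErrorChannel Unit Unit where
  rel _ _ := True
  total _ := ⟨(), True.intro⟩

/-- `a` is an ambiguity of `W`: `W → List_a` and `List_a → W`, where `List_a` is `List_{a,a+1}`
for a positive integer `a`. -/
def IsAmbiguity {X Y : Type*} (W : ZeroErrorChannel X Y) (a : ℕ∞) : Prop :=
  (a = ⊤ ∧ W.Achieves trivial ∧ trivial.Achieves W) ∨
  ∃ (b : ℕ) (hb : 0 < b), a = b ∧
    W.Achieves (list b (b + 1) hb b.lt_succ_self) ∧ (list b (b + 1) hb b.lt_succ_self).Achieves W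

/-- The ambiguity `A(W)`: the (unique) `a` with `W → List_a` and `List_a → W`. -/
noncomputable def ambiguity {X Y : Type*} (W : ZeroErrorChannel X Y) : ℕ∞ :=
  sInf {a | W.IsAmbiguity a}

end ZeroErrorChannel

/-- A communication resource that can be invoked repeatedly, its invocations being possibly
correlated: `uses m` is the zero-error channel made of `m` invocations together. -/
structure Resource (X Y : Type*) where
  uses : ∀ m : ℕ, ZeroErrorChannel (Fin m → X) (Fin m → Y)

namespace Resource

/-- `R → V`: some protocol invoking `R` finitely many times realizes `V` without error. -/
def Achieves {X₀ Y₀ X₁ Y₁ : Type*} (R : Resource X₀ Y₀) (V : ZeroErrorChannel X₁ Y₁) : Prop :=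
  ∃ m : ℕ, (R.uses m).Simulates V

/-- `V → R`: any number of invocations of `R` can be realized by protocols that use `V`. -/
def AchievedBy {X₀ Y₀ X₁ Y₁ : Type*} (R : Resource X₀ Y₀) (V : ZeroErrorChannel X₁ Y₁) : Prop :=
  ∀ m : ℕ, V.Achieves (R.uses m)

/-- `a` is an ambiguity of `R`: `R → List_a` and `List_a → R`. -/
def IsAmbiguity {X Y : Type*} (R : Resource X Y) (a : ℕ∞) : Prop :=
  (a = ⊤ ∧ R.Achieves ZeroErrorChannel.trivial ∧ R.AchievedBy ZeroErrorChannel.trivial) ∨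
  ∃ (b : ℕ) (hb : 0 < b), a = b ∧
    R.Achieves (ZeroErrorChannel.list b (b + 1) hb b.lt_succ_self) ∧
    R.AchievedBy (ZeroErrorChannel.list b (b + 1) hb b.lt_succ_self)

/-- The ambiguity of `R`: the (unique) `a` with `R → List_a` and `List_a → R`. -/
noncomputable def ambiguity {X Y : Type*} (R : Resource X Y) : ℕ∞ :=
  sInf {a | R.IsAmbiguity a}

/-- A zero-error channel as a resource: its invocations are independent. -/
def ofChannel {X Y : Type*} (W : ZeroErrorChannel X Y) : Resource X Y := ⟨W.uses⟩

/-- The parallel concatenation of the channels `W j` with the honest set structure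
`{h i | i}`. In one invocation the sender puts one symbol into every channel and the receiver
gets one symbol from every channel. One honest set `h i`, unknown to sender and receiver, is in
force in all the invocations; the channels outside it are malicious and give arbitrary output. -/
def parallel {n k : ℕ} {X Y : Fin n → Type*} (W : ∀ j, ZeroErrorChannel (X j) (Y j))
    (h : Fin k → Finset (Fin n)) (hk : 0 < k) : Resource (∀ j, X j) (∀ j, Y j) where
  uses _ :=
    { rel := fun x y => ∃ i, ∀ j ∈ h i, ∀ t, (W j).rel (x t j) (y t j)
      total := fun x =>
        ⟨fun t j => ((W j).total (x t j)).choose, ⟨0, hk⟩,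
          fun j _ t => ((W j).total (x t j)).choose_spec⟩ }

/-- Realizing any number of independent invocations of `W` is the same as realizing one. -/
theorem ofChannel_achievedBy_iff {X₀ Y₀ X₁ Y₁ : Type*} (W : ZeroErrorChannel X₀ Y₀)
    (V : ZeroErrorChannel X₁ Y₁) : (ofChannel W).AchievedBy V ↔ V.Achieves W := by
  constructor
  · intro H
    obtain ⟨m, enc, dec, hp⟩ := H 1
    exact ⟨m, fun x => enc fun _ => x, fun y => dec y 0, fun x y hy => hp _ y hy 0⟩
  · rintro ⟨m, enc, dec, hp⟩ r
    refine ⟨r * m, fun x s => enc (x (finProdFinEquiv.symm s).1) (finProdFinEquiv.symm s).2,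
      fun y t => dec fun s => y (finProdFinEquiv (t, s)), fun x y hy t => hp _ _ fun s => ?_⟩
    simpa using hy (finProdFinEquiv (t, s))

/-- The ambiguity of a channel, viewed as a resource, is the ambiguity of the channel. -/
theorem ofChannel_isAmbiguity_iff {X Y : Type*} (W : ZeroErrorChannel X Y) (a : ℕ∞) :
    (ofChannel W).IsAmbiguity a ↔ W.IsAmbiguity a := by
  simp only [IsAmbiguity, ZeroErrorChannel.IsAmbiguity, ofChannel_achievedBy_iff]
  rfl

end Resource

/-- The possible values of `a_1 + ⋯ + a_k` for nonnegative integers `a_i` such that, for every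
channel `j`, the sum of the `a_i` over all `i` with `j ∈ h i` is at most `A j`. -/
def honestSums {n k : ℕ} (A : Fin n → ℕ∞) (h : Fin k → Finset (Fin n)) : Set ℕ∞ :=
  {s | ∃ a : Fin k → ℕ, (∀ j, ∑ i with j ∈ h i, (a i : ℕ∞) ≤ A j) ∧ s = ∑ i, (a i : ℕ∞)}

/-! ### Achievability in terms of common outputs -/

namespace ZeroErrorChannel

/-! Ambiguity is a statement about common outputs: it is `b` exactly when any `b` inputs share a
possible output but some `b + 1` do not, and `⊤` when all inputs share one. For independent uses,
common outputs are glued position by position, so one use decides.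

For the parallel concatenation, split at most `∑ a i` inputs into classes of size at most `a i` and
let `h i` explain class `i`. Channel `j` must then be correct on at most `A j` inputs only, so a
common output exists (`parallel_exists_common`). Conversely, take as code all maps from `b + 1`
messages to inputs. A common output assigns to each message an honest set, and the class sizes sum
to `b + 1`. If they were inadmissible, more than `A j` messages would trust some `j`, and some map
sends these onto incompatible inputs of `W j` (`parallel_exists_incompatible`). -/

theorem Achieves.simulates {X₀ Y₀ X₁ Y₁ X₂ Y₂ : Type*} {U : ZeroErrorChannel X₀ Y₀}
    {W : ZeroErrorChannel X₁ Y₁} {V : ZeroErrorChannel X₂ Y₂} (h₁ : U.Achieves W)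
    (h₂ : W.Simulates V) : U.Achieves V := by
  obtain ⟨m, e, d, h⟩ := h₁
  obtain ⟨e', d', h'⟩ := h₂
  exact ⟨m, e ∘ e', d' ∘ d, fun x y hy => h' _ _ (h _ _ hy)⟩

/-- A channel with `b + 1` inputs that have no common output simulates `List_b`. -/
theorem simulates_list {X Y : Type*} {W : ZeroErrorChannel X Y} {b : ℕ} (hb : 0 < b)
    (f : Fin (b + 1) → X) (hf : ∀ y, ∃ s, ¬ W.rel (f s) y) :
    W.Simulates (list b (b + 1) hb b.lt_succ_self) := by
  choose g hg using hf
  refine ⟨f, fun y => ⟨Finset.univ.erase (g y), by simp⟩, fun x y hxy => ?_⟩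
  refine Finset.mem_erase.2 ⟨?_, Finset.mem_univ x⟩
  rintro rfl
  exact hg y hxy

/-- A channel that simulates `List_b` has `b + 1` inputs without a common output. -/
theorem Simulates.exists_incompatible {X Y : Type*} {W : ZeroErrorChannel X Y} {b : ℕ}
    {hb : 0 < b} (h : W.Simulates (list b (b + 1) hb b.lt_succ_self)) :
    ∃ f : Fin (b + 1) → X, ∀ y, ∃ s, ¬ W.rel (f s) y := by
  obtain ⟨e, d, h⟩ := h
  refine ⟨e, fun y => ?_⟩
  by_contra! hy
  have huniv : (d y).1 = Finset.univ := Finset.eq_univ_of_forall fun s => h s y (hy s)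
  have hcard := (d y).2
  rw [huniv, Finset.card_univ, Fintype.card_fin] at hcard
  omega

/-- If some number of uses of `W` simulates `List_b`, then `W` has `b + 1` inputs without a common
output. -/
theorem Achieves.exists_incompatible {X Y : Type*} {W : ZeroErrorChannel X Y} {b : ℕ}
    {hb : 0 < b} (h : W.Achieves (list b (b + 1) hb b.lt_succ_self)) :
    ∃ f : Fin (b + 1) → X, ∀ y, ∃ s, ¬ W.rel (f s) y := by
  obtain ⟨m, h⟩ := h
  obtain ⟨f, hf⟩ := h.exists_incompatible
  -- Otherwise a common output at each position would glue to a common output of the code words `f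
  -- s`.
  by_contra! hc
  choose y hy using fun t : Fin m => hc fun s => f s t
  obtain ⟨s, hs⟩ := hf y
  exact hs fun t => hy t s

/-- Inputs that have a common output in every invocation have one in `m` invocations together. -/
theorem uses_exists_common {X Y : Type*} {W : ZeroErrorChannel X Y} {a : ℕ∞}
    (h : ∀ F : Finset X, (F.card : ℕ∞) ≤ a → ∃ y, ∀ x ∈ F, W.rel x y) (m : ℕ)
    (F : Finset (Fin m → X)) (hF : (F.card : ℕ∞) ≤ a) : ∃ y, ∀ x ∈ F, (W.uses m).rel x y := by
  classical
  choose y hy using fun t : Fin m => h (F.image fun x => x t)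
    (le_trans (Nat.cast_le.2 Finset.card_image_le) hF)
  exact ⟨y, fun x hx t => hy t _ (Finset.mem_image_of_mem (fun x => x t) hx)⟩

/-- If `List_a` achieves `V`, then any `a` inputs of `V` have a common output. -/
theorem Achieves.exists_common {X Y : Type*} {V : ZeroErrorChannel X Y} {a : ℕ} {ha : 0 < a}
    (h : (list a (a + 1) ha a.lt_succ_self).Achieves V) (F : Finset X) (hF : F.card ≤ a) :
    ∃ y, ∀ x ∈ F, V.rel x y := by
  classical
  obtain ⟨m, e, d, h⟩ := h
  obtain ⟨y, hy⟩ := uses_exists_common (W := list a (a + 1) ha a.lt_succ_self) (a := a)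
    (fun F hF => by
      obtain ⟨y, hFy, -, hy⟩ := Finset.exists_subsuperset_card_eq (Finset.subset_univ F)
        (Nat.cast_le.1 hF) (by simp)
      exact ⟨⟨y, hy⟩, fun x hx => hFy hx⟩) m (F.image e)
    (Nat.cast_le.2 (Finset.card_image_le.trans hF))
  exact ⟨d y, fun x hx => h x y (hy _ (Finset.mem_image_of_mem e hx))⟩

theorem Achieves.exists_common_of_trivial {X Y : Type*} {V : ZeroErrorChannel X Y}
    (h : trivial.Achieves V) : ∃ y, ∀ x, V.rel x y := by
  obtain ⟨m, e, d, h⟩ := h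
  exact ⟨d fun _ => (), fun x => h x _ fun _ => True.intro⟩

theorem trivial_achieves {X Y : Type*} {V : ZeroErrorChannel X Y} {y : Y}
    (h : ∀ x, V.rel x y) : trivial.Achieves V :=
  ⟨0, fun _ _ => (), fun _ => y, fun x _ _ => h x⟩

/-- Makes the code of all maps work: too large a set of surviving messages covers, at some position,
any prescribed `a + 1` symbols. -/
theorem exists_map_finset_surjOn {X Z : Type*} [Nonempty Z] {a : ℕ} (f : Fin (a + 1) → Z)
    (C : Finset X) (hC : a < C.card) : ∃ φ : X → Z, ∀ s, ∃ x ∈ C, φ x = f s := by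
  classical
  have hcard : Fintype.card (Fin (a + 1)) ≤ Fintype.card C := by simpa using hC
  obtain ⟨g⟩ := Function.Embedding.nonempty_of_card_le hcard
  have hinj : Function.Injective fun s => (g s : X) := Subtype.val_injective.comp g.injective
  exact ⟨Function.extend (fun s => (g s : X)) f fun _ => Classical.arbitrary Z,
    fun s => ⟨g s, (g s).2, hinj.extend_apply _ _ _⟩⟩

/-- If any `a` inputs of `V` have a common output, then `List_a` achieves `V`: the code word of an
input `x` is the sequence of the values `φ x`, where `φ` runs through all maps from the inputs of
`V` to those of `List_a`. -/
theorem list_achieves {X Y : Type*} [Finite X] {V : ZeroErrorChannel X Y} {a : ℕ} (ha : 0 < a)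
    (h : ∀ F : Finset X, F.card ≤ a → ∃ y, ∀ x ∈ F, V.rel x y) :
    (list a (a + 1) ha a.lt_succ_self).Achieves V := by
  classical
  have := Fintype.ofFinite X
  let φ := (Fintype.equivFin (X → Fin (a + 1))).symm
  -- `C y` is the set of inputs still compatible with the received `y`.
  let C := fun y : Fin (Fintype.card (X → Fin (a + 1))) →
    {y : Finset (Fin (a + 1)) // y.card = a} => {x : X | ∀ t, φ t x ∈ (y t).1}.toFinset
  have hC : ∀ y, (C y).card ≤ a := by
    intro y
    by_contra! hlt
    obtain ⟨ψ, hψ⟩ := exists_map_finset_surjOn id (C y) hlt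
    have huniv : (y (φ.symm ψ)).1 = Finset.univ := Finset.eq_univ_of_forall fun s => by
      obtain ⟨x, hx, rfl⟩ := hψ s
      have := Set.mem_toFinset.1 hx (φ.symm ψ)
      rwa [φ.apply_symm_apply] at this
    have hcard := (y (φ.symm ψ)).2
    rw [huniv, Finset.card_univ, Fintype.card_fin] at hcard
    omega
  choose d hd using fun y => h (C y) (hC y)
  exact ⟨_, fun x t => φ t x, d, fun x y hy => hd y x (Set.mem_toFinset.2 hy)⟩

theorem list_achieves_list_le {a b : ℕ} {ha : 0 < a} {hb : 0 < b}
    (h : (list a (a + 1) ha a.lt_succ_self).Achieves (list b (b + 1) hb b.lt_succ_self)) :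
    a ≤ b := by
  by_contra! hlt
  obtain ⟨y, hy⟩ := h.exists_common Finset.univ (by simpa using hlt)
  have huniv : y.1 = Finset.univ := Finset.eq_univ_of_forall fun s => hy s (Finset.mem_univ s)
  have hcard := y.2
  rw [huniv, Finset.card_univ, Fintype.card_fin] at hcard
  omega

theorem not_trivial_achieves_list {b : ℕ} {hb : 0 < b} :
    ¬ trivial.Achieves (list b (b + 1) hb b.lt_succ_self) := by
  intro h
  obtain ⟨y, hy⟩ := h.exists_common_of_trivial
  have huniv : y.1 = Finset.univ := Finset.eq_univ_of_forall hy
  have hcard := y.2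
  rw [huniv, Finset.card_univ, Fintype.card_fin] at hcard
  omega

end ZeroErrorChannel

/-! ### Uniqueness and criteria for ambiguity -/

namespace Resource

open ZeroErrorChannel

variable {X Y : Type*} {R : Resource X Y}

theorem IsAmbiguity.unique {a b : ℕ∞} (ha : R.IsAmbiguity a) (hb : R.IsAmbiguity b) : a = b := by
  rcases ha with ⟨rfl, -, ha⟩ | ⟨a, ha, rfl, ⟨m, ha₁⟩, ha₂⟩ <;>
  rcases hb with ⟨rfl, -, hb⟩ | ⟨b, hb, rfl, ⟨m', hb₁⟩, hb₂⟩
  · rfl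
  · exact absurd ((ha m').simulates hb₁) not_trivial_achieves_list
  · exact absurd ((hb m).simulates ha₁) not_trivial_achieves_list
  · exact congrArg _ (le_antisymm (list_achieves_list_le ((ha₂ m').simulates hb₁))
      (list_achieves_list_le ((hb₂ m).simulates ha₁)))

theorem IsAmbiguity.ambiguity_eq {a : ℕ∞} (ha : R.IsAmbiguity a) : R.ambiguity = a := by
  have : {b | R.IsAmbiguity b} = {a} :=
    Set.eq_singleton_iff_unique_mem.2 ⟨ha, fun b hb => hb.unique ha⟩
  rw [ambiguity, this, sInf_singleton]

theorem isAmbiguity_top [Nonempty X] (h : ∀ m, ∃ y, ∀ x, (R.uses m).rel x y) :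
    R.IsAmbiguity ⊤ := by
  refine Or.inl ⟨rfl, ⟨0, fun _ _ => Classical.arbitrary X, fun _ => (), fun _ _ _ => True.intro⟩,
    fun m => ?_⟩
  obtain ⟨y, hy⟩ := h m
  exact trivial_achieves hy

theorem isAmbiguity_coe [Finite X] {b : ℕ} (hb : 0 < b) (m : ℕ) (f : Fin (b + 1) → Fin m → X)
    (hf : ∀ y, ∃ s, ¬ (R.uses m).rel (f s) y)
    (h : ∀ m, ∀ F : Finset (Fin m → X), F.card ≤ b → ∃ y, ∀ x ∈ F, (R.uses m).rel x y) :
    R.IsAmbiguity b :=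
  Or.inr ⟨b, hb, rfl, ⟨m, simulates_list hb f hf⟩, fun m => list_achieves hb (h m)⟩

end Resource

/-! ### Existence for a single channel -/

namespace ZeroErrorChannel

variable {X Y : Type*} {W : ZeroErrorChannel X Y}

theorem IsAmbiguity.unique {a b : ℕ∞} (ha : W.IsAmbiguity a) (hb : W.IsAmbiguity b) : a = b :=
  ((Resource.ofChannel_isAmbiguity_iff W a).2 ha).unique
    ((Resource.ofChannel_isAmbiguity_iff W b).2 hb)

theorem IsAmbiguity.ambiguity_eq {a : ℕ∞} (ha : W.IsAmbiguity a) : W.ambiguity = a := by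
  have : {b | W.IsAmbiguity b} = {a} :=
    Set.eq_singleton_iff_unique_mem.2 ⟨ha, fun b hb => hb.unique ha⟩
  rw [ambiguity, this, sInf_singleton]

theorem IsAmbiguity.pos {a : ℕ∞} (ha : W.IsAmbiguity a) : 0 < a := by
  rcases ha with ⟨rfl, -⟩ | ⟨b, hb, rfl, -⟩
  · simp
  · exact_mod_cast hb

theorem IsAmbiguity.exists_incompatible {b : ℕ} (h : W.IsAmbiguity b) :
    ∃ f : Fin (b + 1) → X, ∀ y, ∃ s, ¬ W.rel (f s) y := by
  rcases h with ⟨h, -⟩ | ⟨c, hc, hbc, h, -⟩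
  · exact absurd h (ENat.natCast_ne_top b)
  · obtain rfl : b = c := Nat.cast_injective hbc
    exact h.exists_incompatible

theorem IsAmbiguity.exists_common {a : ℕ∞} (h : W.IsAmbiguity a) (F : Finset X)
    (hF : (F.card : ℕ∞) ≤ a) : ∃ y, ∀ x ∈ F, W.rel x y := by
  rcases h with ⟨rfl, -, h⟩ | ⟨b, hb, rfl, -, h⟩
  · obtain ⟨y, hy⟩ := h.exists_common_of_trivial
    exact ⟨y, fun x _ => hy x⟩
  · exact h.exists_common F (Nat.cast_le.1 hF)

theorem exists_isAmbiguity [Finite X] [Nonempty X] (W : ZeroErrorChannel X Y) :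
    ∃ a, W.IsAmbiguity a := by
  classical
  simp only [← Resource.ofChannel_isAmbiguity_iff]
  by_cases hW : ∃ y, ∀ x, W.rel x y
  · obtain ⟨y, hy⟩ := hW
    exact ⟨⊤, Resource.isAmbiguity_top fun m => ⟨fun _ => y, fun x t => hy (x t)⟩⟩
  · push Not at hW
    have := Fintype.ofFinite X
    -- The ambiguity is one less than the least size of a set of inputs without a common output.
    have hex : ∃ c, ∃ F : Finset X, F.card = c ∧ ∀ y, ∃ x ∈ F, ¬ W.rel x y :=
      ⟨_, Finset.univ, rfl, fun y => by simpa using hW y⟩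
    obtain ⟨F, hcard, hF⟩ := Nat.find_spec hex
    have hmin : ∀ G : Finset X, G.card < F.card → ∃ y, ∀ x ∈ G, W.rel x y := by
      intro G hG
      by_contra! hc
      exact Nat.find_min hex (hcard ▸ hG) ⟨G, rfl, hc⟩
    -- By totality a single input has an output, so this size is at least two and the ambiguity is
    -- positive.
    obtain ⟨y₀, hy₀⟩ := W.total (Classical.arbitrary X)
    obtain ⟨x₀, hx₀, -⟩ := hF y₀
    obtain ⟨y₁, hy₁⟩ := W.total x₀
    obtain ⟨x₁, hx₁, hxy⟩ := hF y₁
    have hlt : 1 < F.card := Finset.one_lt_card.2 ⟨x₀, hx₀, x₁, hx₁, by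
      rintro rfl
      exact hxy hy₁⟩
    obtain ⟨b, hb⟩ : ∃ b, F.card = b + 1 := ⟨F.card - 1, by omega⟩
    refine ⟨b, Resource.isAmbiguity_coe (by omega) 1
      (fun s _ => (F.equivFinOfCardEq hb).symm s) (fun y => ?_) fun m G hG => ?_⟩
    · obtain ⟨x, hx, hxy⟩ := hF (y 0)
      exact ⟨F.equivFinOfCardEq hb ⟨x, hx⟩, fun H => hxy (by simpa using H 0)⟩
    · exact uses_exists_common (a := b)
        (fun G hG => hmin G (by rw [hb]; exact Nat.lt_succ_of_le (Nat.cast_le.1 hG))) m G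
        (Nat.cast_le.2 hG)

end ZeroErrorChannel

/-! ### Splitting inputs among honest sets -/

/-- Inject `F` into the disjoint union of `a i` slots for each `i`, and read off the index. -/
theorem exists_map_fin_card_fiber_le {α : Type*} [DecidableEq α] {k : ℕ} (hk : 0 < k)
    (F : Finset α) (a : Fin k → ℕ) (h : F.card ≤ ∑ i, a i) :
    ∃ g : α → Fin k, ∀ i, (F.filter fun x => g x = i).card ≤ a i := by
  have : Nonempty (Fin k) := ⟨⟨0, hk⟩⟩
  have hcard : Fintype.card F ≤ Fintype.card (Σ i, Fin (a i)) := by simpa using h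
  obtain ⟨e⟩ := Function.Embedding.nonempty_of_card_le hcard
  refine ⟨fun x => if hx : x ∈ F then (e ⟨x, hx⟩).1 else Classical.arbitrary _, fun i => ?_⟩
  have hinj : Function.Injective fun x : {x : F // (e x).1 = i} =>
      (⟨e x.1, x.2⟩ : {p : Σ i, Fin (a i) // p.1 = i}) := fun x y hxy =>
    Subtype.ext (e.injective (congrArg Subtype.val hxy))
  have h₁ := Fintype.card_le_of_injective _ hinj
  rw [Fintype.card_congr (Equiv.sigmaSubtype i), Fintype.card_fin] at h₁
  refine le_trans ?_ h₁
  rw [← Fintype.card_coe]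
  refine Fintype.card_le_of_injective (fun x => ⟨⟨x.1, (Finset.mem_filter.1 x.2).1⟩, ?_⟩) ?_
  · have hx := Finset.mem_filter.1 x.2
    simpa [hx.1] using hx.2
  · intro x y hxy
    exact Subtype.ext (congrArg (fun z => (z.1 : α)) hxy)

theorem card_filter_mem_eq_sum {α : Type*} {n k : ℕ} (F : Finset α) (g : α → Fin k)
    (h : Fin k → Finset (Fin n)) (j : Fin n) :
    (F.filter fun x => j ∈ h (g x)).card = ∑ i with j ∈ h i, (F.filter fun x => g x = i).card := by
  classical
  rw [Finset.card_eq_sum_card_fiberwise (f := g) (t := Finset.univ.filter fun i => j ∈ h i)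
    (fun x hx => by simpa using (Finset.mem_filter.1 hx).2)]
  refine Finset.sum_congr rfl fun i hi => ?_
  congr 1
  ext x
  simp only [Finset.mem_filter, Finset.mem_univ, true_and] at hi ⊢
  constructor
  · rintro ⟨⟨hx, -⟩, hg⟩
    exact ⟨hx, hg⟩
  · rintro ⟨hx, rfl⟩
    exact ⟨⟨hx, hi⟩, rfl⟩

/-! ### Ambiguity of the parallel concatenation -/

namespace Resource

open ZeroErrorChannel

variable {n k : ℕ} {X Y : Fin n → Type*} {W : ∀ j, ZeroErrorChannel (X j) (Y j)}
  {h : Fin k → Finset (Fin n)} {A : Fin n → ℕ∞}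

theorem parallel_exists_common (hk : 0 < k) (hA : ∀ j, (W j).IsAmbiguity (A j)) {s : ℕ∞}
    (hs : s ∈ honestSums A h) (m : ℕ) (F : Finset (Fin m → ∀ j, X j)) (hF : (F.card : ℕ∞) ≤ s) :
    ∃ y, ∀ x ∈ F, ((parallel W h hk).uses m).rel x y := by
  classical
  obtain ⟨a, ha, rfl⟩ := hs
  obtain ⟨g, hg⟩ := exists_map_fin_card_fiber_le hk F a (by exact_mod_cast hF)
  have hcommon : ∀ j, ∃ y, ∀ x ∈ (F.filter fun x => j ∈ h (g x)).image (fun x t => x t j),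
      ((W j).uses m).rel x y := by
    intro j
    refine uses_exists_common (fun G hG => (hA j).exists_common G hG) m _ ?_
    refine le_trans (Nat.cast_le.2 Finset.card_image_le) (le_trans ?_ (ha j))
    rw [card_filter_mem_eq_sum, Nat.cast_sum]
    exact Finset.sum_le_sum fun i _ => Nat.cast_le.2 (hg i)
  choose y hy using hcommon
  refine ⟨fun t j => y j t, fun x hx => ⟨g x, fun j hj t => ?_⟩⟩
  exact hy j _ (Finset.mem_image_of_mem (fun (x : Fin m → ∀ j, X j) t => x t j)
    (Finset.mem_filter.2 ⟨hx, hj⟩)) t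

/-- If no admissible sum equals `b + 1`, then there are `b + 1` inputs of some number of uses of the
parallel concatenation without a common output. The code word of `s` consists of the values `φ s`
of all maps `φ` from `Fin (b + 1)` to the inputs. -/
theorem parallel_exists_incompatible [∀ j, Finite (X j)] [∀ j, Nonempty (X j)] (hk : 0 < k)
    (hA : ∀ j, (W j).IsAmbiguity (A j)) {b : ℕ} (hb : ((b + 1 : ℕ) : ℕ∞) ∉ honestSums A h) :
    ∃ (m : ℕ) (f : Fin (b + 1) → Fin m → ∀ j, X j),
      ∀ y, ∃ s, ¬ ((parallel W h hk).uses m).rel (f s) y := by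
  classical
  have := Fintype.ofFinite (Fin (b + 1) → ∀ j, X j)
  let φ := (Fintype.equivFin (Fin (b + 1) → ∀ j, X j)).symm
  refine ⟨_, fun s t => φ t s, fun y => ?_⟩
  by_contra! hy
  choose g hg using hy
  -- `g s` is an honest set explaining `y` for message `s`; the fibre sizes of `g` are the `a i`.
  refine hb ⟨fun i => (Finset.univ.filter fun s => g s = i).card, fun j => ?_, ?_⟩
  · rw [← Nat.cast_sum, ← card_filter_mem_eq_sum]
    by_contra! hlt
    obtain ⟨c, hc⟩ := ENat.ne_top_iff_exists.1 hlt.ne_top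
    have hAj := hA j
    rw [← hc] at hlt hAj
    obtain ⟨f, hf⟩ := hAj.exists_incompatible
    obtain ⟨ψ, hψ⟩ := exists_map_finset_surjOn f _ (Nat.cast_lt.1 hlt)
    -- Only the symbol sent through channel `j` matters.
    let Ψ : Fin (b + 1) → ∀ j, X j := fun s =>
      Function.update (fun _ => Classical.arbitrary _) j (ψ s)
    obtain ⟨r, hr⟩ := hf (y (φ.symm Ψ) j)
    obtain ⟨s, hs, hsr⟩ := hψ r
    have := hg s j (Finset.mem_filter.1 hs).2 (φ.symm Ψ)
    simp only [φ.apply_symm_apply, Ψ, Function.update_self, hsr] at this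
    exact hr this
  · rw [← Nat.cast_sum, ← Finset.card_eq_sum_card_fiberwise (fun s _ => by simp)]
    simp

theorem parallel_isAmbiguity [∀ j, Finite (X j)] [∀ j, Nonempty (X j)] (hk : 0 < k)
    (hA : ∀ j, (W j).IsAmbiguity (A j)) :
    (parallel W h hk).IsAmbiguity (sSup (honestSums A h)) ∧
      (sSup (honestSums A h) ≠ ⊤ → sSup (honestSums A h) ∈ honestSums A h) := by
  classical
  -- Makes the set of sums nonempty and, below, `b` positive.
  have hone : (1 : ℕ∞) ∈ honestSums A h := by
    refine ⟨Pi.single ⟨0, hk⟩ 1, fun j => ?_, ?_⟩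
    · refine le_trans ?_ (Order.one_le_iff_pos.2 (hA j).pos)
      rw [← Nat.cast_sum]
      refine Nat.cast_le_one.2 ?_
      refine (Finset.sum_le_sum_of_subset (Finset.subset_univ _)).trans ?_
      simp
    · rw [← Nat.cast_sum]
      simp
  have hmem : sSup (honestSums A h) ≠ ⊤ → sSup (honestSums A h) ∈ honestSums A h := fun hne =>
    have : Nonempty (honestSums A h) := ⟨1, hone⟩
    ENat.sSup_mem_of_nonempty_of_lt_top hne.lt_top
  refine ⟨?_, hmem⟩
  by_cases htop : sSup (honestSums A h) = ⊤
  · rw [htop]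
    refine isAmbiguity_top fun m => ?_
    have := Fintype.ofFinite (Fin m → ∀ j, X j)
    -- Some admissible sum exceeds the number of all inputs of `m` uses, so all of them share an
    -- output.
    obtain ⟨s, hs, hlt⟩ := sSup_eq_top.1 htop _
      (ENat.natCast_lt_top (Finset.univ : Finset (Fin m → ∀ j, X j)).card)
    obtain ⟨y, hy⟩ := parallel_exists_common hk hA hs m Finset.univ hlt.le
    exact ⟨y, fun x => hy x (Finset.mem_univ x)⟩
  · have hb := hmem htop
    obtain ⟨b, hbs⟩ := ENat.ne_top_iff_exists.1 htop
    have hle : ∀ s ∈ honestSums A h, s ≤ b := fun s hs => hbs ▸ le_sSup hs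
    rw [← hbs] at hb ⊢
    obtain ⟨m, f, hf⟩ := parallel_exists_incompatible (b := b) hk hA fun hmem => by
      have := Nat.cast_le.1 (hle _ hmem)
      omega
    exact isAmbiguity_coe (by exact_mod_cast Order.one_le_iff_pos.1 (hle 1 hone)) m f hf fun m F hF =>
      parallel_exists_common hk hA hb m F (Nat.cast_le.2 hF)

end Resource

theorem mainTheorem5 {n k : ℕ} (hk : 0 < k) {X Y : Fin n → Type*}
    [∀ j, Finite (X j)] [∀ j, Nonempty (X j)]
    (W : ∀ j, ZeroErrorChannel (X j) (Y j)) (h : Fin k → Finset (Fin n)) :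
    (∀ j, ∃! a, (W j).IsAmbiguity a) ∧
    (∃! a, (Resource.parallel W h hk).IsAmbiguity a) ∧
    IsLUB (honestSums (fun j => (W j).ambiguity) h) (Resource.parallel W h hk).ambiguity ∧
    ((Resource.parallel W h hk).ambiguity ≠ ⊤ →
      IsGreatest (honestSums (fun j => (W j).ambiguity) h)
        (Resource.parallel W h hk).ambiguity) := by
  have hA : ∀ j, (W j).IsAmbiguity (W j).ambiguity := fun j => by
    obtain ⟨a, ha⟩ := (W j).exists_isAmbiguity
    rwa [ha.ambiguity_eq]
  obtain ⟨hp, hmem⟩ := Resource.parallel_isAmbiguity (h := h) hk hA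
  rw [hp.ambiguity_eq]
  exact ⟨fun j => ⟨_, hA j, fun a ha => ha.unique (hA j)⟩, ⟨_, hp, fun a ha => ha.unique hp⟩,
    isLUB_sSup _, fun hne => ⟨hmem hne, fun s hs => le_sSup hs⟩⟩
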